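/- Let $\mathcal H=\{x\in\mathbb R^{4}: -x_0^2+x_1^2+x_2^2+x_3^2=1\}$ be the unit hyperboloid (three-dimensional de Sitter space) with the metric $h$ induced by the Minkowski metric; in the coordinates $x=(\sinh\tau,\cosh\tau\, n)$, $\tau\in\mathbb R$, $n\in S^2$, it reads $h=-d\tau^2+\cosh^2\tau\,(d\theta^2+\sin^2\theta\, d\phi^2)$. Let $D_a$ be the Levi-Civita connection of $h$, $\square=h^{ab}D_aD_b$, let $\epsilon_{abc}$ be the volume form of $h$, and for a symmetric tensor put $(\operatorname{curl}T)_{ab}=\epsilon_a{}^{cd}D_cT_{db}$. All fields are real, smooth and defined on the whole of $\mathcal H$. Let $T_{ab}$ be a symmetric tensor field on $\mathcal H$ with $h^{ab}T_{ab}=0$, $\operatorname{curl}T=0$, $D^bT_{ab}=0$ and $\square T_{ab}=3T_{ab}$. Then there is a function $\Phi$ on $\mathcal H$ such that $$T_{ab}=D_aD_b\Phi+h_{ab}\Phi,\qquad \square\Phi+3\Phi=0 .$$ Moreover $\Phi$ is determined exactly up to adding a linear combination of the four functions $$\zeta_{(0)}=\sinh\tau,\quad \zeta_{(1)}=\cosh\tau\cos\theta,\quad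 \zeta_{(2)}=\cosh\tau\sin\theta\cos\phi,\quad \zeta_{(3)}=\cosh\tau\sin\theta\sin\phi :$$ a function $\Psi$ satisfies the same two equations if and only if $\Psi=\Phi+\sum_{i=0}^{3}c_i\,\zeta_{(i)}$ for some $c_0,\dots,c_3\in\mathbb R$. -/

import Mathlib

open scoped ContDiff

noncomputable section

namespace DeSitter

/-! ### Tensor calculus of a metric given by its components in coordinates

Coordinates run over `ℝ³`; a covariant tensor field is the family of its component functions. -/

/-- The coordinate space. -/
abbrev Coord : Type := EuclideanSpace ℝ (Fin 3)

/-- The partial derivative `∂_a f`. -/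
def pd (a : Fin 3) (f : Coord → ℝ) (y : Coord) : ℝ :=
  fderiv ℝ f y (EuclideanSpace.single a 1)

/-- The Christoffel symbols of the metric `g`:
`Γ^e_{ab} = ½ g^{ef} (∂_a g_{bf} + ∂_b g_{af} - ∂_f g_{ab})`. -/
def christoffel (g : Coord → Matrix (Fin 3) (Fin 3) ℝ) (y : Coord) (e a b : Fin 3) : ℝ :=
  (1 / 2) * ∑ f, (g y)⁻¹ e f *
    (pd a (fun z => g z b f) y + pd b (fun z => g z a f) y - pd f (fun z => g z a b) y)

/-- The Levi-Civita covariant derivative `D_a w_b` of a covector field. -/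
def cov1 (g : Coord → Matrix (Fin 3) (Fin 3) ℝ) (w : Coord → Fin 3 → ℝ)
    (y : Coord) (a b : Fin 3) : ℝ :=
  pd a (fun z => w z b) y - ∑ e, christoffel g y e a b * w y e

/-- The Levi-Civita covariant derivative `D_c T_{ab}` of a covariant tensor field of rank 2;
the derivative index comes first. -/
def cov2 (g : Coord → Matrix (Fin 3) (Fin 3) ℝ) (T : Coord → Fin 3 → Fin 3 → ℝ)
    (y : Coord) (c a b : Fin 3) : ℝ :=
  pd c (fun z => T z a b) y - ∑ e, christoffel g y e c a * T y e b
    - ∑ e, christoffel g y e c b * T y a e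

/-- The Levi-Civita covariant derivative `D_d S_{cab}` of a covariant tensor field of rank 3;
the derivative index comes first. -/
def cov3 (g : Coord → Matrix (Fin 3) (Fin 3) ℝ) (S : Coord → Fin 3 → Fin 3 → Fin 3 → ℝ)
    (y : Coord) (d c a b : Fin 3) : ℝ :=
  pd d (fun z => S z c a b) y - ∑ e, christoffel g y e d c * S y e a b
    - ∑ e, christoffel g y e d a * S y c e b - ∑ e, christoffel g y e d b * S y c a e

/-- `D_a D_b Φ`, where `D_b Φ = ∂_b Φ`. -/
def hess (g : Coord → Matrix (Fin 3) (Fin 3) ℝ) (Φ : Coord → ℝ) (y : Coord) (a b : Fin 3) : ℝ :=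
  cov1 g (fun z c => pd c Φ z) y a b

/-- `□Φ = g^{ab} D_a D_b Φ`. -/
def box0 (g : Coord → Matrix (Fin 3) (Fin 3) ℝ) (Φ : Coord → ℝ) (y : Coord) : ℝ :=
  ∑ a, ∑ b, (g y)⁻¹ a b * hess g Φ y a b

/-- The trace `g^{ab} T_{ab}`. -/
def tr (g : Coord → Matrix (Fin 3) (Fin 3) ℝ) (T : Coord → Fin 3 → Fin 3 → ℝ) (y : Coord) : ℝ :=
  ∑ a, ∑ b, (g y)⁻¹ a b * T y a b

/-- The divergence `D^b T_{ab} = g^{bc} D_c T_{ab}`. -/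
def dvg (g : Coord → Matrix (Fin 3) (Fin 3) ℝ) (T : Coord → Fin 3 → Fin 3 → ℝ)
    (y : Coord) (a : Fin 3) : ℝ :=
  ∑ b, ∑ c, (g y)⁻¹ b c * cov2 g T y c a b

/-- `(□T)_{ab} = g^{cd} D_c D_d T_{ab}`. -/
def box2 (g : Coord → Matrix (Fin 3) (Fin 3) ℝ) (T : Coord → Fin 3 → Fin 3 → ℝ)
    (y : Coord) (a b : Fin 3) : ℝ :=
  ∑ c, ∑ d, (g y)⁻¹ c d * cov3 g (cov2 g T) y c d a b

/-- The permutation symbol `[abc]`, with `[012] = 1`. -/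
def perm (a b c : Fin 3) : ℝ :=
  ((b.val : ℝ) - (a.val : ℝ)) * ((c.val : ℝ) - (a.val : ℝ)) * ((c.val : ℝ) - (b.val : ℝ)) / 2

/-- The volume tensor `ε_{abc} = √|det g| [abc]`. -/
def eps (g : Coord → Matrix (Fin 3) (Fin 3) ℝ) (y : Coord) (a b c : Fin 3) : ℝ :=
  Real.sqrt |(g y).det| * perm a b c

/-- The curl `(curl T)_{ab} = ε_a^{cd} D_c T_{db}`. -/
def curl (g : Coord → Matrix (Fin 3) (Fin 3) ℝ) (T : Coord → Fin 3 → Fin 3 → ℝ)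
    (y : Coord) (a b : Fin 3) : ℝ :=
  ∑ c, ∑ d, (∑ p, ∑ q, (g y)⁻¹ c p * (g y)⁻¹ d q * eps g y a p q) * cov2 g T y c d b

/-! ### The unit hyperboloid

The hyperboloid is `ℝ × S²`, with points `(sinh τ, cosh τ n)`, `τ ∈ ℝ`, `n ∈ S²`. It is covered by
one global chart, with values `y = exp(τ) n` in `ℝ³ ∖ {0}`; so `τ = log ‖y‖`, `n = y / ‖y‖`. -/

/-- The unit hyperboloid `-x₀² + x₁² + x₂² + x₃² = 1` in Minkowski space. -/
def hyperboloid : Set (Fin 4 → ℝ) :=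
  {x | -(x 0) ^ 2 + (x 1) ^ 2 + (x 2) ^ 2 + (x 3) ^ 2 = 1}

/-- The range of the global chart. -/
def U : Set Coord := {y | y ≠ 0}

/-- The time coordinate `τ`. -/
def tau (y : Coord) : ℝ := Real.log ‖y‖

/-- The point of the hyperboloid with chart value `y`. -/
def embed (y : Coord) : Fin 4 → ℝ :=
  ![Real.sinh (tau y), Real.cosh (tau y) * (y 0 / ‖y‖), Real.cosh (tau y) * (y 1 / ‖y‖),
    Real.cosh (tau y) * (y 2 / ‖y‖)]

/-- The chart, the inverse of `embed`. -/
def chart (x : Fin 4 → ℝ) : Coord :=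
  (Real.exp (Real.arsinh (x 0)) / ‖(!₂[x 1, x 2, x 3] : Coord)‖) • !₂[x 1, x 2, x 3]

theorem embed_chart : Set.InvOn chart embed U hyperboloid ∧ Set.MapsTo embed U hyperboloid ∧
    Set.MapsTo chart hyperboloid U := by
  have hpos : ∀ y ∈ U, 0 < ‖y‖ := fun y hy => norm_pos_iff.2 hy
  have hn : ∀ y ∈ U, (y 0 / ‖y‖) ^ 2 + (y 1 / ‖y‖) ^ 2 + (y 2 / ‖y‖) ^ 2 = 1 := by
    intro y hy
    have h0 := (hpos y hy).ne'
    have h1 := EuclideanSpace.real_norm_sq_eq y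
    rw [Fin.sum_univ_three] at h1
    field_simp
    linarith
  have hx : ∀ x ∈ hyperboloid, ‖(!₂[x 1, x 2, x 3] : Coord)‖ = Real.cosh (Real.arsinh (x 0)) := by
    intro x hx
    have h1 := EuclideanSpace.real_norm_sq_eq (!₂[x 1, x 2, x 3] : Coord)
    simp only [Fin.sum_univ_three] at h1
    simp at h1
    simp only [hyperboloid, Set.mem_ofPred_eq] at hx
    have h2 := Real.cosh_sq (Real.arsinh (x 0))
    rw [Real.sinh_arsinh] at h2
    refine (sq_eq_sq₀ (norm_nonneg _) (Real.cosh_pos _).le).1 ?_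
    linarith
  refine ⟨⟨?_, ?_⟩, ?_, ?_⟩
  · intro y hy
    have h0 := hpos y hy
    have hv : (!₂[embed y 1, embed y 2, embed y 3] : Coord) = (Real.cosh (tau y) / ‖y‖) • y := by
      ext i
      fin_cases i <;> simp [embed] <;> ring
    have hc := Real.cosh_pos (tau y)
    unfold chart
    rw [hv, norm_smul, Real.norm_of_nonneg (by positivity), div_mul_cancel₀ _ h0.ne', smul_smul]
    have : Real.exp (Real.arsinh (embed y 0)) = ‖y‖ := by
      simp [embed, Real.arsinh_sinh, tau, Real.exp_log h0]
    rw [this]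
    have : ‖y‖ / Real.cosh (tau y) * (Real.cosh (tau y) / ‖y‖) = 1 := by field_simp
    rw [this, one_smul]
  · intro x hxm
    have h1 := hx x hxm
    have hc := Real.cosh_pos (Real.arsinh (x 0))
    have he := Real.exp_pos (Real.arsinh (x 0))
    have hnorm : ‖chart x‖ = Real.exp (Real.arsinh (x 0)) := by
      unfold chart
      rw [norm_smul, h1, Real.norm_of_nonneg (by positivity), div_mul_cancel₀ _ hc.ne']
    have ht : tau (chart x) = Real.arsinh (x 0) := by
      rw [tau, hnorm, Real.log_exp]
    have h3 : ∀ i, chart x i = Real.exp (Real.arsinh (x 0)) / Real.cosh (Real.arsinh (x 0)) *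
        (!₂[x 1, x 2, x 3] : Coord) i := by
      intro i
      simp only [chart, h1, PiLp.smul_apply, smul_eq_mul]
    ext i
    fin_cases i
    · simp [embed, ht]
    all_goals
      simp only [embed, hnorm, ht, h3]
      simp
      field_simp
  · intro y hy
    have h1 := hn y hy
    have h2 := Real.cosh_sq (tau y)
    simp only [hyperboloid, Set.mem_ofPred_eq, embed]
    simp
    linear_combination Real.cosh (tau y) ^ 2 * h1 + h2
  · intro x hxm
    have h1 := hx x hxm
    have hc := Real.cosh_pos (Real.arsinh (x 0))
    have he := Real.exp_pos (Real.arsinh (x 0))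
    have : 0 < ‖chart x‖ := by
      unfold chart
      rw [norm_smul, h1, Real.norm_of_nonneg (by positivity), div_mul_cancel₀ _ hc.ne']
      exact he
    exact norm_pos_iff.1 this

/-- `embed` and `chart` are smooth, the latter even on a neighbourhood of the hyperboloid. -/
theorem contDiffOn_embed_chart : ContDiffOn ℝ ∞ embed U ∧
    ContDiffOn ℝ ∞ chart {x | (!₂[x 1, x 2, x 3] : Coord) ≠ 0} := by
  have hcoord : ∀ i, ContDiffOn ℝ ∞ (fun y : Coord => y i) U := fun i => by fun_prop
  have hnrm : ContDiffOn ℝ ∞ (fun y : Coord => ‖y‖) U :=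
    contDiffOn_id.norm ℝ fun y hy => hy
  have htau : ContDiffOn ℝ ∞ tau U := hnrm.log fun y hy => norm_ne_zero_iff.2 hy
  have hdir : ∀ i, ContDiffOn ℝ ∞ (fun y : Coord => y i / ‖y‖) U := fun i =>
    (hcoord i).div hnrm fun y hy => norm_ne_zero_iff.2 hy
  constructor
  · rw [contDiffOn_pi]
    intro m
    fin_cases m
    · exact Real.contDiff_sinh.comp_contDiffOn htau
    · exact (Real.contDiff_cosh.comp_contDiffOn htau).mul (hdir 0)
    · exact (Real.contDiff_cosh.comp_contDiffOn htau).mul (hdir 1)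
    · exact (Real.contDiff_cosh.comp_contDiffOn htau).mul (hdir 2)
  · have hv : ContDiff ℝ ∞ (fun x : Fin 4 → ℝ => (!₂[x 1, x 2, x 3] : Coord)) := by
      rw [contDiff_euclidean]
      intro i
      fin_cases i <;> simp <;> fun_prop
    have he : ContDiff ℝ ∞ (fun x : Fin 4 → ℝ => Real.exp (Real.arsinh (x 0))) := by
      exact Real.contDiff_exp.comp (Real.contDiff_arsinh.comp (by fun_prop))
    exact (he.contDiffOn.div (hv.contDiffOn.norm ℝ fun x hx => hx)
      fun x hx => norm_ne_zero_iff.2 hx).smul hv.contDiffOn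

/-- The Minkowski metric `diag(-1, 1, 1, 1)`. -/
def eta : Fin 4 → ℝ := ![-1, 1, 1, 1]

/-- The metric of the hyperboloid, induced by the Minkowski metric, in the global chart. -/
def h (y : Coord) : Matrix (Fin 3) (Fin 3) ℝ :=
  Matrix.of fun a b =>
    ∑ m, eta m * pd a (fun z => embed z m) y * pd b (fun z => embed z m) y

/-- The `l = 1` harmonics `cos θ`, `sin θ cos φ`, `sin θ sin φ` on the sphere. -/
def harm (k : Fin 3) (y : Coord) : ℝ := ![y 2, y 0, y 1] k / ‖y‖

/-- The four functions `ζ₍₀₎ = sinh τ` and `ζ₍ₖ₎ = cosh τ f₍ₖ₎`. -/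
def zeta (i : Fin 4) (y : Coord) : ℝ :=
  Fin.cases (Real.sinh (tau y)) (fun k => Real.cosh (tau y) * harm k y) i

/-- `Φ` is a smooth function on the hyperboloid with `□Φ + 3Φ = 0` and
`T_{ab} = D_a D_b Φ + h_{ab} Φ`. -/
def IsPotential (T : Coord → Fin 3 → Fin 3 → ℝ) (Φ : Coord → ℝ) : Prop :=
  ContDiffOn ℝ ∞ Φ U ∧ (∀ y ∈ U, box0 h Φ y + 3 * Φ y = 0) ∧
    ∀ y ∈ U, ∀ a b, T y a b = hess h Φ y a b + h y a b * Φ y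

end DeSitter

end

/-!
Let `x = embed y` be the position vector of the hyperboloid in Minkowski space `ℝ⁴`. The vectors
`x, ∂₀x, ∂₁x, ∂₂x` form a basis of `ℝ⁴` with `⟨x, x⟩ = 1`, `⟨x, ∂_a x⟩ = 0` and
`⟨∂_a x, ∂_b x⟩ = h_{ab}`, so identities between vectors may be tested against it
(`eq_of_mink_eq`). The Gauss formula (`tangentDeriv_eq`) reads `D_a D_b x = -h_{ab} x`.

Put `v_a = T_a{}^b ∂_b x`, an `ℝ⁴`-valued covector field. By the Gauss formula,
`∂_c v_a - ∂_a v_c` has tangential part `D_c T_{ab} - D_a T_{cb}`, which vanishes because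
`curl T = 0` (`cov2_comm_of_curl_eq_zero`), and normal part `T_{ca} - T_{ac} = 0`. As `ℝ × S²` is
simply connected, `v_a = ∂_a w` for some `w : U → ℝ⁴` (`exists_pd_eq_of_closed`). Then
`Φ = ⟨w, x⟩` has `∂_b Φ = ⟨w, ∂_b x⟩`, and one more derivative gives
`D_a D_b Φ = T_{ab} - h_{ab} Φ` (`hess_mink_embed`); the trace of this is `□Φ + 3Φ = 0`.

For uniqueness, let `Θ` be the difference of two potentials, so `D_a D_b Θ + h_{ab} Θ = 0`. The
vector `D^aΘ ∂_a x + Θ x` then has derivative zero, hence is a constant `k`, and `Θ = ⟨k, x⟩`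
(`hess_add_h_mul_eq_zero_iff`); the components of `x` are the functions `ζ₍ᵢ₎` up to order.
-/

noncomputable section

namespace DeSitter

open Set

/-! ### Partial derivatives -/

theorem isOpen_U : IsOpen U := isOpen_ne

theorem isPreconnected_U : IsPreconnected U :=
  (isConnected_compl_singleton_of_one_lt_rank (E := Coord) (by
    rw [← Module.finrank_eq_rank, finrank_euclideanSpace_fin]; norm_num) 0).isPreconnected

theorem U_mem_nhds {y : Coord} (hy : y ∈ U) : U ∈ nhds y := isOpen_U.mem_nhds hy

theorem differentiableAt_of_contDiffOn_U {f : Coord → ℝ} (hf : ContDiffOn ℝ ∞ f U)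
    {y : Coord} (hy : y ∈ U) : DifferentiableAt ℝ f y :=
  (hf.contDiffAt (U_mem_nhds hy)).differentiableAt (by simp)

theorem pd_congr {f g : Coord → ℝ} (hfg : ∀ z ∈ U, f z = g z) (a : Fin 3) {y : Coord}
    (hy : y ∈ U) : pd a f y = pd a g y := by
  have : f =ᶠ[nhds y] g := Filter.eventuallyEq_of_mem (U_mem_nhds hy) hfg
  rw [pd, pd, this.fderiv_eq]

theorem pd_const (a : Fin 3) (r : ℝ) (y : Coord) : pd a (fun _ => r) y = 0 := by
  simp [pd]

theorem pd_add {f g : Coord → ℝ} {y : Coord} (hf : DifferentiableAt ℝ f y)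
    (hg : DifferentiableAt ℝ g y) (a : Fin 3) :
    pd a (fun z => f z + g z) y = pd a f y + pd a g y := by
  simp [pd, fderiv_fun_add hf hg]

theorem pd_mul {f g : Coord → ℝ} {y : Coord} (hf : DifferentiableAt ℝ f y)
    (hg : DifferentiableAt ℝ g y) (a : Fin 3) :
    pd a (fun z => f z * g z) y = pd a f y * g y + f y * pd a g y := by
  simp [pd, fderiv_fun_mul hf hg]
  ring

theorem pd_sum {ι : Type*} (s : Finset ι) {f : ι → Coord → ℝ} {y : Coord}
    (hf : ∀ i ∈ s, DifferentiableAt ℝ (f i) y) (a : Fin 3) :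
    pd a (fun z => ∑ i ∈ s, f i z) y = ∑ i ∈ s, pd a (f i) y := by
  simp [pd, fderiv_fun_sum hf]

theorem contDiffOn_pd {f : Coord → ℝ} (hf : ContDiffOn ℝ ∞ f U) (a : Fin 3) :
    ContDiffOn ℝ ∞ (pd a f) U :=
  ((contDiffOn_infty_iff_fderiv_of_isOpen isOpen_U).1 hf).2.clm_apply contDiffOn_const

theorem pd_comm {f : Coord → ℝ} (hf : ContDiffOn ℝ ∞ f U) (a b : Fin 3) {y : Coord}
    (hy : y ∈ U) : pd a (pd b f) y = pd b (pd a f) y := by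
  have hd : DifferentiableAt ℝ (fderiv ℝ f) y :=
    (((contDiffOn_infty_iff_fderiv_of_isOpen isOpen_U).1 hf).2.contDiffAt
      (U_mem_nhds hy)).differentiableAt (by simp)
  have key : ∀ c d : Fin 3, pd c (pd d f) y =
      fderiv ℝ (fderiv ℝ f) y (EuclideanSpace.single c 1) (EuclideanSpace.single d 1) := by
    intro c d
    have h2 : pd d f = fun z => fderiv ℝ f z (EuclideanSpace.single d 1) := rfl
    rw [h2, pd, fderiv_clm_apply hd (differentiableAt_const _)]
    simp
  rw [key, key]
  exact ((hf.contDiffAt (U_mem_nhds hy)).isSymmSndFDerivAt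
    (by simpa using WithTop.coe_le_coe.2 (le_top : (2 : ℕ∞) ≤ ⊤))) _ _

theorem fderiv_apply_eq_sum_pd (f : Coord → ℝ) (y u : Coord) :
    fderiv ℝ f y u = ∑ a, u a * pd a f y := by
  have hu : u = ∑ a, u a • EuclideanSpace.single a (1 : ℝ) := by
    ext i
    simp [Fin.sum_univ_three]
    fin_cases i <;> simp
  conv_lhs => rw [hu]
  simp [pd]

theorem exists_const_of_pd_eq_zero {f : Coord → ℝ} (hf : ContDiffOn ℝ ∞ f U)
    (h0 : ∀ y ∈ U, ∀ a, pd a f y = 0) : ∃ r, ∀ y ∈ U, f y = r := by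
  refine isOpen_U.exists_is_const_of_fderiv_eq_zero isPreconnected_U
    (hf.differentiableOn (by simp)) fun y hy => ?_
  ext u
  simp [fderiv_apply_eq_sum_pd, h0 y hy]

/-! ### The Poincaré lemma on the punctured space -/

/-- Primitives of a `1`-form on two open sets with preconnected intersection differ there by a
constant, so they can be glued. -/
theorem exists_primitive_union {E : Type*} [NormedAddCommGroup E] [NormedSpace ℝ E]
    {α : E → E →L[ℝ] ℝ} {A B : Set E}
    (hA : IsOpen A) (hB : IsOpen B) (hAB : IsPreconnected (A ∩ B))
    (pA : ∃ f : E → ℝ, ∀ y ∈ A, HasFDerivAt f (α y) y)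
    (pB : ∃ f : E → ℝ, ∀ y ∈ B, HasFDerivAt f (α y) y) :
    ∃ f : E → ℝ, ∀ y ∈ A ∪ B, HasFDerivAt f (α y) y := by
  classical
  obtain ⟨f, hf⟩ := pA
  obtain ⟨g, hg⟩ := pB
  obtain ⟨r, hr⟩ := (hA.inter hB).exists_eq_add_of_fderiv_eq hAB
    (fun y hy => (hf y hy.1).differentiableAt.differentiableWithinAt)
    (fun y hy => (hg y hy.2).differentiableAt.differentiableWithinAt)
    (fun y hy => (hf y hy.1).fderiv.trans (hg y hy.2).fderiv.symm)
  refine ⟨fun y => if y ∈ A then f y else g y + r, ?_⟩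
  have onB : ∀ y ∈ B, (if y ∈ A then f y else g y + r) = g y + r := by
    intro y hy
    split_ifs with h1
    · exact hr ⟨h1, hy⟩
    · rfl
  rintro y (hy | hy)
  · exact (hf y hy).congr_of_eventuallyEq
      (Filter.eventuallyEq_of_mem (hA.mem_nhds hy) fun z hz => if_pos hz)
  · exact ((hg y hy).add_const r).congr_of_eventuallyEq
      (Filter.eventuallyEq_of_mem (hB.mem_nhds hy) onB)

/-- Four half-spaces whose defining linear forms add up to zero. They cover `U`, and any three of
them have a point in common. -/
def halfSpace (i : Fin 4) : Set Coord := {y | 0 < ![y 0, y 1, y 2, -(y 0 + y 1 + y 2)] i}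

theorem isOpen_halfSpace (i : Fin 4) : IsOpen (halfSpace i) := by
  fin_cases i <;> (refine isOpen_lt continuous_const ?_; simp; fun_prop)

theorem convex_halfSpace (i : Fin 4) : Convex ℝ (halfSpace i) := by
  intro x hx y hy s t hs ht hst
  have key : ∀ p q : ℝ, 0 < p → 0 < q → 0 < s * p + t * q := by
    intro p q hp hq
    rcases hs.eq_or_lt with rfl | hs'
    · have : t = 1 := by linarith
      simpa [this] using hq
    · have := mul_pos hs' hp
      have := mul_nonneg ht hq.le
      linarith
  have := key _ _ hx hy
  simp only [halfSpace, mem_ofPred_eq]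
  convert this using 1
  fin_cases i <;> simp
  ring

theorem halfSpace_subset_U (i : Fin 4) : halfSpace i ⊆ U := by
  rintro y hy rfl
  fin_cases i <;> simp [halfSpace] at hy

theorem U_subset_halfSpaces :
    U ⊆ ((halfSpace 0 ∪ halfSpace 1) ∪ halfSpace 2) ∪ halfSpace 3 := by
  intro y hy
  by_contra hc
  simp [halfSpace] at hc
  obtain ⟨⟨⟨h0, h1⟩, h2⟩, h3⟩ := hc
  apply hy
  ext i
  fin_cases i <;> simp <;> linarith

/-- The half-spaces are added one at a time. At each step the intersection with the new one is a
union of convex sets with common points, hence preconnected. -/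
theorem exists_primitive_U {α : Coord → Coord →L[ℝ] ℝ} (hα : DifferentiableOn ℝ α U)
    (hclosed : ∀ y ∈ U, ∀ u v, fderiv ℝ α y u v = fderiv ℝ α y v u) :
    ∃ f : Coord → ℝ, ∀ y ∈ U, HasFDerivAt f (α y) y := by
  have p : ∀ i, ∃ f : Coord → ℝ, ∀ y ∈ halfSpace i, HasFDerivAt f (α y) y := fun i =>
    (convex_halfSpace i).exists_forall_hasFDerivAt_of_fderiv_symmetric (isOpen_halfSpace i)
      (hα.mono (halfSpace_subset_U i)) fun y hy => hclosed y (halfSpace_subset_U i hy)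
  have c : ∀ i j, IsPreconnected (halfSpace i ∩ halfSpace j) := fun i j =>
    ((convex_halfSpace i).inter (convex_halfSpace j)).isPreconnected
  have o := isOpen_halfSpace
  have p01 := exists_primitive_union (o 0) (o 1) (c 0 1) (p 0) (p 1)
  have c012 : IsPreconnected ((halfSpace 0 ∪ halfSpace 1) ∩ halfSpace 2) := by
    rw [union_inter_distrib_right]
    -- `(1, 1, 1)` lies in the half-spaces `0, 1, 2`.
    refine IsPreconnected.union !₂[1, 1, 1] ?_ ?_ (c 0 2) (c 1 2) <;> simp [halfSpace]
  have p012 := exists_primitive_union ((o 0).union (o 1)) (o 2) c012 p01 (p 2)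
  have c0123 : IsPreconnected (((halfSpace 0 ∪ halfSpace 1) ∪ halfSpace 2) ∩ halfSpace 3) := by
    rw [union_inter_distrib_right, union_inter_distrib_right]
    -- `(-3, 1, 1)` lies in the half-spaces `1, 2, 3` and `(1, 1, -3)` in `0, 1, 3`.
    refine IsPreconnected.union !₂[-3, 1, 1] ?_ ?_
      (IsPreconnected.union !₂[1, 1, -3] ?_ ?_ (c 0 3) (c 1 3)) (c 2 3) <;>
      simp [halfSpace] <;> norm_num
  obtain ⟨f, hf⟩ :=
    exists_primitive_union (((o 0).union (o 1)).union (o 2)) (o 3) c0123 p012 (p 3)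
  exact ⟨f, fun y hy => hf y (U_subset_halfSpaces hy)⟩

/-- On `U = ℝ³ ∖ {0}`, which is simply connected, every closed smooth covector field is a
gradient. -/
theorem exists_pd_eq_of_closed {v : Fin 3 → Coord → ℝ} (hv : ∀ a, ContDiffOn ℝ ∞ (v a) U)
    (hclosed : ∀ y ∈ U, ∀ a c, pd c (v a) y = pd a (v c) y) :
    ∃ w : Coord → ℝ, ContDiffOn ℝ ∞ w U ∧ ∀ y ∈ U, ∀ a, pd a w y = v a y := by
  let P : Fin 3 → Coord →L[ℝ] ℝ := fun a => EuclideanSpace.proj a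
  set α : Coord → Coord →L[ℝ] ℝ := fun y => ∑ a, v a y • P a with hαdef
  have hα : ContDiffOn ℝ ∞ α U :=
    ContDiffOn.sum fun a _ => (hv a).smul contDiffOn_const
  have hαd : DifferentiableOn ℝ α U := hα.differentiableOn (by simp)
  have happ : ∀ y u, α y u = ∑ a, v a y * u a := by
    intro y u
    simp [hαdef, P]
  have hfd : ∀ y ∈ U, ∀ u u', fderiv ℝ α y u u' = ∑ a, ∑ c, u c * pd c (v a) y * u' a := by
    intro y hy u u'
    have h1 : HasFDerivAt α (∑ a, (fderiv ℝ (v a) y).smulRight (P a)) y :=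
      HasFDerivAt.fun_sum fun a _ =>
        (differentiableAt_of_contDiffOn_U (hv a) hy).hasFDerivAt.smul_const (P a)
    rw [h1.fderiv]
    simp [fderiv_apply_eq_sum_pd, Finset.sum_mul, P]
  obtain ⟨w, hw⟩ := exists_primitive_U hαd (by
    intro y hy u u'
    rw [hfd y hy, hfd y hy, Finset.sum_comm]
    refine Finset.sum_congr rfl fun a _ => Finset.sum_congr rfl fun c _ => ?_
    rw [hclosed y hy a c]
    ring)
  refine ⟨w, ?_, ?_⟩
  · rw [contDiffOn_infty_iff_fderiv_of_isOpen isOpen_U]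
    exact ⟨fun y hy => (hw y hy).differentiableAt.differentiableWithinAt,
      hα.congr fun y hy => (hw y hy).fderiv⟩
  · intro y hy a
    rw [pd, (hw y hy).fderiv, happ]
    simp

/-! ### The adapted frame of Minkowski space along the hyperboloid -/

/-- The Minkowski inner product of `ℝ⁴`. -/
def mink (u v : Fin 4 → ℝ) : ℝ := ∑ m, eta m * u m * v m

/-- The tangent vector `∂_a x` of the hyperboloid `x = embed y`, as a vector of `ℝ⁴`. -/
def tangent (y : Coord) (a : Fin 3) : Fin 4 → ℝ := fun m => pd a (fun z => embed z m) y

theorem mink_comm (u v : Fin 4 → ℝ) : mink u v = mink v u :=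
  Finset.sum_congr rfl fun _ _ => by ring

theorem mink_add_left (u u' v : Fin 4 → ℝ) : mink (u + u') v = mink u v + mink u' v := by
  simp only [mink, Pi.add_apply, ← Finset.sum_add_distrib]
  exact Finset.sum_congr rfl fun _ _ => by ring

theorem mink_smul_left (r : ℝ) (u v : Fin 4 → ℝ) : mink (r • u) v = r * mink u v := by
  simp only [mink, Pi.smul_apply, smul_eq_mul, Finset.mul_sum]
  exact Finset.sum_congr rfl fun _ _ => by ring

theorem mink_sub_left (u u' v : Fin 4 → ℝ) : mink (u - u') v = mink u v - mink u' v := by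
  simp only [mink, Pi.sub_apply, ← Finset.sum_sub_distrib]
  exact Finset.sum_congr rfl fun _ _ => by ring

theorem mink_sum_left {ι : Type*} (s : Finset ι) (u : ι → Fin 4 → ℝ) (v : Fin 4 → ℝ) :
    mink (∑ i ∈ s, u i) v = ∑ i ∈ s, mink (u i) v := by
  simp only [mink, Finset.sum_apply, Finset.mul_sum, Finset.sum_mul]
  exact Finset.sum_comm

theorem mink_add_right (u v v' : Fin 4 → ℝ) : mink u (v + v') = mink u v + mink u v' := by
  rw [mink_comm, mink_add_left, mink_comm v, mink_comm v']

theorem mink_smul_right (r : ℝ) (u v : Fin 4 → ℝ) : mink u (r • v) = r * mink u v := by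
  rw [mink_comm, mink_smul_left, mink_comm]

theorem mink_sub_right (u v v' : Fin 4 → ℝ) : mink u (v - v') = mink u v - mink u v' := by
  rw [mink_comm, mink_sub_left, mink_comm v, mink_comm v']

theorem mink_sum_right {ι : Type*} (s : Finset ι) (u : Fin 4 → ℝ) (v : ι → Fin 4 → ℝ) :
    mink u (∑ i ∈ s, v i) = ∑ i ∈ s, mink u (v i) := by
  rw [mink_comm, mink_sum_left]
  exact Finset.sum_congr rfl fun _ _ => mink_comm _ _

theorem pd_mink {u v : Coord → Fin 4 → ℝ} (hu : ∀ m, ContDiffOn ℝ ∞ (fun z => u z m) U)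
    (hv : ∀ m, ContDiffOn ℝ ∞ (fun z => v z m) U) (a : Fin 3) {y : Coord} (hy : y ∈ U) :
    pd a (fun z => mink (u z) (v z)) y =
      mink (fun m => pd a (fun z => u z m) y) (v y) +
        mink (u y) (fun m => pd a (fun z => v z m) y) := by
  have hu' := fun m => differentiableAt_of_contDiffOn_U (hu m) hy
  have hv' := fun m => differentiableAt_of_contDiffOn_U (hv m) hy
  simp only [mink]
  rw [pd_sum _ fun m _ => ((hu' m).const_mul (eta m)).fun_mul (hv' m), ← Finset.sum_add_distrib]
  refine Finset.sum_congr rfl fun m _ => ?_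
  rw [pd_mul ((hu' m).const_mul (eta m)) (hv' m), pd_mul (differentiableAt_const _) (hu' m),
    pd_const]
  ring

theorem contDiffOn_mink {u v : Coord → Fin 4 → ℝ} (hu : ∀ m, ContDiffOn ℝ ∞ (fun z => u z m) U)
    (hv : ∀ m, ContDiffOn ℝ ∞ (fun z => v z m) U) :
    ContDiffOn ℝ ∞ (fun z => mink (u z) (v z)) U :=
  ContDiffOn.sum fun m _ => (contDiffOn_const.mul (hu m)).mul (hv m)

theorem contDiffOn_embed (m : Fin 4) : ContDiffOn ℝ ∞ (fun z => embed z m) U :=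
  contDiffOn_pi.1 contDiffOn_embed_chart.1 m

theorem contDiffOn_tangent (a : Fin 3) (m : Fin 4) :
    ContDiffOn ℝ ∞ (fun z => tangent z a m) U :=
  contDiffOn_pd (contDiffOn_embed m) a

theorem h_eq_mink (y : Coord) (a b : Fin 3) : h y a b = mink (tangent y a) (tangent y b) := rfl

theorem h_symm (y : Coord) (a b : Fin 3) : h y a b = h y b a := by
  rw [h_eq_mink, mink_comm, ← h_eq_mink]

theorem mink_embed_embed {y : Coord} (hy : y ∈ U) : mink (embed y) (embed y) = 1 := by
  have h1 : embed y ∈ hyperboloid := embed_chart.2.1 hy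
  simp only [hyperboloid, mem_ofPred_eq] at h1
  rw [← h1]
  simp [mink, eta, Fin.sum_univ_four]
  ring

theorem mink_embed_tangent {y : Coord} (hy : y ∈ U) (a : Fin 3) :
    mink (embed y) (tangent y a) = 0 := by
  have h1 := pd_mink contDiffOn_embed contDiffOn_embed a hy
  rw [pd_congr (fun z hz => mink_embed_embed hz) a hy, pd_const] at h1
  change 0 = mink (tangent y a) (embed y) + mink (embed y) (tangent y a) at h1
  rw [mink_comm (tangent y a)] at h1
  linarith

theorem mink_tangent_embed {y : Coord} (hy : y ∈ U) (a : Fin 3) :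
    mink (tangent y a) (embed y) = 0 := by
  rw [mink_comm, mink_embed_tangent hy]

/-- The tangent vectors are independent because `embed` has the smooth left inverse `chart`. -/
theorem linearIndependent_tangent {y : Coord} (hy : y ∈ U) :
    LinearIndependent ℝ (tangent y) := by
  have hE : DifferentiableAt ℝ embed y :=
    (contDiffOn_embed_chart.1.contDiffAt (U_mem_nhds hy)).differentiableAt (by simp)
  have hopen : IsOpen {x : Fin 4 → ℝ | (!₂[x 1, x 2, x 3] : Coord) ≠ 0} := by
    refine isOpen_ne_fun ?_ continuous_const
    refine (PiLp.continuous_toLp 2 _).comp (continuous_pi fun i => ?_)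
    fin_cases i <;> simp <;> fun_prop
  have hmem : embed y ∈ {x : Fin 4 → ℝ | (!₂[x 1, x 2, x 3] : Coord) ≠ 0} := by
    intro h0
    have h1 : chart (embed y) = y := embed_chart.1.1 hy
    refine hy ?_
    rw [← h1, chart, h0, smul_zero]
  have hC : DifferentiableAt ℝ chart (embed y) :=
    (contDiffOn_embed_chart.2.contDiffAt (hopen.mem_nhds hmem)).differentiableAt (by simp)
  have hcomp : (fderiv ℝ chart (embed y)).comp (fderiv ℝ embed y) =
      ContinuousLinearMap.id ℝ Coord := by
    rw [← fderiv_comp y hC hE]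
    have : chart ∘ embed =ᶠ[nhds y] id :=
      Filter.eventuallyEq_of_mem (U_mem_nhds hy) embed_chart.1.1
    rw [this.fderiv_eq, fderiv_id]
  have htan : ∀ a, tangent y a = fderiv ℝ embed y (EuclideanSpace.single a 1) := by
    intro a
    ext m
    rw [fderiv_pi (fun i => differentiableAt_pi.1 hE i)]
    rfl
  refine LinearIndependent.of_comp (fderiv ℝ chart (embed y)).toLinearMap ?_
  have : (fderiv ℝ chart (embed y)).toLinearMap ∘ tangent y =
      (EuclideanSpace.basisFun (Fin 3) ℝ).toBasis := by
    funext a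
    have h1 := congrArg (fun L => L (EuclideanSpace.single a (1 : ℝ))) hcomp
    simp only [ContinuousLinearMap.comp_apply, ContinuousLinearMap.id_apply] at h1
    simpa [htan] using h1
  rw [this]
  exact Module.Basis.linearIndependent _

/-- The position vector and the three tangent vectors span `ℝ⁴`, so a vector orthogonal to all
four vanishes. -/
theorem eq_zero_of_mink_eq_zero {y : Coord} (hy : y ∈ U) {w : Fin 4 → ℝ}
    (htan : ∀ a, mink w (tangent y a) = 0) (hemb : mink w (embed y) = 0) : w = 0 := by
  have hli : LinearIndependent ℝ (Fin.cons (embed y) (tangent y) : Fin 4 → Fin 4 → ℝ) := by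
    refine linearIndependent_finCons.2 ⟨linearIndependent_tangent hy, fun hmem => ?_⟩
    have : ∀ v ∈ Submodule.span ℝ (range (tangent y)), mink (embed y) v = 0 := by
      intro v hv
      induction hv using Submodule.span_induction with
      | mem v hv => obtain ⟨a, rfl⟩ := hv; exact mink_embed_tangent hy a
      | zero => simp [mink]
      | add u v _ _ hu hv => rw [mink_add_right, hu, hv, add_zero]
      | smul r v _ hv => rw [mink_smul_right, hv, mul_zero]
    have h1 := this _ hmem
    rw [mink_embed_embed hy] at h1
    exact one_ne_zero h1
  have hspan := hli.span_eq_top_of_card_eq_finrank (by simp)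
  have hall : ∀ v, mink w v = 0 := by
    intro v
    have hv : v ∈ Submodule.span ℝ
        (range (Fin.cons (embed y) (tangent y) : Fin 4 → Fin 4 → ℝ)) := by
      rw [hspan]; trivial
    induction hv using Submodule.span_induction with
    | mem v hv =>
      obtain ⟨a, rfl⟩ := hv
      refine Fin.cases ?_ (fun i => ?_) a
      · simpa using hemb
      · simpa using htan i
    | zero => simp [mink]
    | add u v _ _ hu hv => rw [mink_add_right, hu, hv, add_zero]
    | smul r v _ hv => rw [mink_smul_right, hv, mul_zero]
  ext m
  have h1 := hall (Pi.single m 1)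
  simp only [mink, Pi.single_apply, mul_ite, mul_one, mul_zero, Finset.sum_ite_eq',
    Finset.mem_univ, if_true] at h1
  fin_cases m <;> simpa [eta] using h1

theorem eq_of_mink_eq {y : Coord} (hy : y ∈ U) {u w : Fin 4 → ℝ}
    (htan : ∀ a, mink u (tangent y a) = mink w (tangent y a))
    (hemb : mink u (embed y) = mink w (embed y)) : u = w := by
  refine sub_eq_zero.1 (eq_zero_of_mink_eq_zero hy (fun a => ?_) ?_)
  · rw [mink_sub_left, htan, sub_self]
  · rw [mink_sub_left, hemb, sub_self]

theorem det_h_ne_zero {y : Coord} (hy : y ∈ U) : (h y).det ≠ 0 := by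
  intro hdet
  obtain ⟨v, hv0, hv⟩ := Matrix.exists_mulVec_eq_zero_iff.2 hdet
  refine hv0 (funext fun a => ?_)
  refine Fintype.linearIndependent_iff.1 (linearIndependent_tangent hy) v
    (eq_zero_of_mink_eq_zero hy (fun b => ?_) ?_) a
  · have h1 := congrFun hv b
    simp only [mink_sum_left, mink_smul_left, ← h_eq_mink]
    rw [Pi.zero_apply, Matrix.mulVec, dotProduct] at h1
    rw [← h1]
    exact Finset.sum_congr rfl fun c _ => by rw [h_symm y c b, mul_comm]
  · simp [mink_sum_left, mink_smul_left, mink_tangent_embed hy]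

theorem inv_h_mul_h {y : Coord} (hy : y ∈ U) (a b : Fin 3) :
    ∑ c, (h y)⁻¹ a c * h y c b = if a = b then 1 else 0 := by
  have h1 := Matrix.nonsing_inv_mul (h y) (isUnit_iff_ne_zero.2 (det_h_ne_zero hy))
  have h2 := congrFun (congrFun h1 a) b
  rwa [Matrix.mul_apply, Matrix.one_apply] at h2

theorem h_mul_inv_h {y : Coord} (hy : y ∈ U) (a b : Fin 3) :
    ∑ c, h y a c * (h y)⁻¹ c b = if a = b then 1 else 0 := by
  have h1 := Matrix.mul_nonsing_inv (h y) (isUnit_iff_ne_zero.2 (det_h_ne_zero hy))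
  have h2 := congrFun (congrFun h1 a) b
  rwa [Matrix.mul_apply, Matrix.one_apply] at h2

theorem contDiffOn_h (a b : Fin 3) : ContDiffOn ℝ ∞ (fun z => h z a b) U :=
  contDiffOn_mink (contDiffOn_tangent a) (contDiffOn_tangent b)

theorem contDiffOn_inv_h (a b : Fin 3) : ContDiffOn ℝ ∞ (fun z => (h z)⁻¹ a b) U := by
  have hdet : ContDiffOn ℝ ∞ (fun z => (h z).det) U := by
    have := contDiffOn_h
    simp only [Matrix.det_fin_three]
    fun_prop
  have hadj : ContDiffOn ℝ ∞ (fun z => (h z).adjugate a b) U := by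
    have := contDiffOn_h
    simp only [Matrix.adjugate_fin_three]
    fin_cases a <;> fin_cases b <;> simp <;> fun_prop
  refine ((hdet.inv fun z hz => det_h_ne_zero hz).mul hadj).congr fun z _ => ?_
  rw [Matrix.inv_def, Matrix.smul_apply, Ring.inverse_eq_inv', smul_eq_mul]
  rfl

/-- The vector of `ℝ⁴` whose inner products with the tangent vectors are the components of the
covector `p`, and whose inner product with the position vector is `s`. -/
def lift (y : Coord) (p : Fin 3 → ℝ) (s : ℝ) : Fin 4 → ℝ :=
  ∑ a, ∑ b, ((h y)⁻¹ a b * p a) • tangent y b + s • embed y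

theorem mink_lift_tangent {y : Coord} (hy : y ∈ U) (p : Fin 3 → ℝ) (s : ℝ) (c : Fin 3) :
    mink (lift y p s) (tangent y c) = p c := by
  simp only [lift, mink_add_left, mink_sum_left, mink_smul_left, mink_embed_tangent hy, mul_zero,
    add_zero, ← h_eq_mink]
  have h1 : ∀ a, ∑ b, (h y)⁻¹ a b * p a * h y b c = p a * if a = c then 1 else 0 := by
    intro a
    rw [← inv_h_mul_h hy, Finset.mul_sum]
    exact Finset.sum_congr rfl fun _ _ => by ring
  simp [h1]

theorem mink_lift_embed {y : Coord} (hy : y ∈ U) (p : Fin 3 → ℝ) (s : ℝ) :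
    mink (lift y p s) (embed y) = s := by
  simp [lift, mink_add_left, mink_sum_left, mink_smul_left, mink_tangent_embed hy,
    mink_embed_embed hy]

theorem contDiffOn_lift {p : Coord → Fin 3 → ℝ} {s : Coord → ℝ}
    (hp : ∀ a, ContDiffOn ℝ ∞ (fun z => p z a) U) (hs : ContDiffOn ℝ ∞ s U) (m : Fin 4) :
    ContDiffOn ℝ ∞ (fun z => lift z (p z) (s z) m) U := by
  simp only [lift, Pi.add_apply, Finset.sum_apply, Pi.smul_apply, smul_eq_mul]
  exact (ContDiffOn.sum fun a _ => ContDiffOn.sum fun b _ =>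
    ((contDiffOn_inv_h a b).mul (hp a)).mul (contDiffOn_tangent b m)).add
      (hs.mul (contDiffOn_embed m))

/-! ### The Gauss formula -/

/-- The second derivative `∂_a ∂_b x` of the position vector `x = embed y`. -/
def tangentDeriv (y : Coord) (a b : Fin 3) : Fin 4 → ℝ := fun m => pd a (fun z => tangent z b m) y

theorem tangentDeriv_comm {y : Coord} (hy : y ∈ U) (a b : Fin 3) :
    tangentDeriv y a b = tangentDeriv y b a :=
  funext fun m => pd_comm (contDiffOn_embed m) a b hy

theorem pd_h {y : Coord} (hy : y ∈ U) (a b c : Fin 3) :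
    pd a (fun z => h z b c) y =
      mink (tangentDeriv y a b) (tangent y c) + mink (tangent y b) (tangentDeriv y a c) :=
  pd_mink (contDiffOn_tangent b) (contDiffOn_tangent c) a hy

theorem mink_tangentDeriv_embed {y : Coord} (hy : y ∈ U) (a b : Fin 3) :
    mink (tangentDeriv y a b) (embed y) = -h y a b := by
  have h1 := pd_mink (contDiffOn_tangent b) contDiffOn_embed a hy
  rw [pd_congr (fun z hz => mink_tangent_embed hz b) a hy, pd_const] at h1
  change 0 = mink (tangentDeriv y a b) (embed y) + mink (tangent y b) (tangent y a) at h1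
  rw [h_symm, h_eq_mink]
  linarith

/-- The Christoffel symbols of the first kind of an induced metric are `⟨∂_a ∂_b x, ∂_c x⟩`. -/
theorem sum_christoffel_mul_h {y : Coord} (hy : y ∈ U) (a b c : Fin 3) :
    ∑ e, christoffel h y e a b * h y e c = mink (tangentDeriv y a b) (tangent y c) := by
  have h1 : ∀ f, pd a (fun z => h z b f) y + pd b (fun z => h z a f) y -
      pd f (fun z => h z a b) y = 2 * mink (tangentDeriv y a b) (tangent y f) := by
    intro f
    rw [pd_h hy, pd_h hy, pd_h hy, tangentDeriv_comm hy b a, tangentDeriv_comm hy f a,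
      tangentDeriv_comm hy f b, mink_comm (tangentDeriv y a f)]
    ring
  simp only [christoffel, h1]
  have h2 : ∀ f, ∑ e, h y c e * (h y)⁻¹ e f * mink (tangentDeriv y a b) (tangent y f) =
      (if c = f then 1 else 0) * mink (tangentDeriv y a b) (tangent y f) := fun f => by
    rw [← h_mul_inv_h hy, Finset.sum_mul]
  calc _ = ∑ e, ∑ f, h y c e * (h y)⁻¹ e f * mink (tangentDeriv y a b) (tangent y f) := by
        refine Finset.sum_congr rfl fun e _ => ?_
        rw [mul_assoc, Finset.sum_mul, Finset.mul_sum]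
        refine Finset.sum_congr rfl fun f _ => ?_
        rw [h_symm y e c]
        ring
    _ = _ := by
        rw [Finset.sum_comm]
        simp [h2]

/-- The Gauss formula `D_a D_b x = -h_{ab} x` for the position vector `x = embed y`. -/
theorem tangentDeriv_eq {y : Coord} (hy : y ∈ U) (a b : Fin 3) :
    tangentDeriv y a b = ∑ e, christoffel h y e a b • tangent y e - h y a b • embed y := by
  refine eq_of_mink_eq hy (fun c => ?_) ?_
  · simp only [mink_sub_left, mink_sum_left, mink_smul_left, ← h_eq_mink, mink_embed_tangent hy,
      sum_christoffel_mul_h hy]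
    ring
  · simp [mink_sub_left, mink_sum_left, mink_smul_left, mink_tangent_embed hy,
      mink_embed_embed hy, mink_tangentDeriv_embed hy]

theorem christoffel_comm {y : Coord} (hy : y ∈ U) (e a b : Fin 3) :
    christoffel h y e a b = christoffel h y e b a := by
  have h1 : ∀ f, pd f (fun z => h z a b) y = pd f (fun z => h z b a) y := fun f =>
    pd_congr (fun z _ => h_symm z a b) f hy
  simp only [christoffel, h1]
  congr 1
  exact Finset.sum_congr rfl fun f _ => by ring

/-! ### Curl-free tensors -/

/-- Vanishing of the curl says that `D_c T_{db}` is symmetric in `c` and `d`. -/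
theorem cov2_comm_of_curl_eq_zero {T : Coord → Fin 3 → Fin 3 → ℝ} {y : Coord} (hy : y ∈ U)
    (hT : ∀ a b, curl h T y a b = 0) (c d b : Fin 3) :
    cov2 h T y c d b = cov2 h T y d c b := by
  set S : Matrix (Fin 3) (Fin 3) ℝ := Matrix.of fun c d => cov2 h T y c d b with hS
  set G := (h y)⁻¹ with hG
  -- `N` is `D_c T_{db}` with the indices `c` and `d` raised.
  set N := G.transpose * S * G with hN
  have hdet : Real.sqrt |(h y).det| ≠ 0 :=
    (Real.sqrt_pos.2 (abs_pos.2 (det_h_ne_zero hy))).ne'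
  have hperm : ∀ a, ∑ p, ∑ q, perm a p q * N p q = 0 := by
    intro a
    refine (mul_eq_zero.1 ?_).resolve_left hdet
    rw [← hT a b]
    simp only [curl, eps, hN, Matrix.mul_apply, Matrix.transpose_apply, hS, Matrix.of_apply,
      Finset.sum_mul, Finset.mul_sum, ← hG]
    calc _ = ∑ p, ∑ c, ∑ q, ∑ d, Real.sqrt |(h y).det| *
          (perm a p q * (G d p * cov2 h T y d c b * G c q)) :=
          Finset.sum_congr rfl fun p _ => Finset.sum_comm
      _ = ∑ c, ∑ p, ∑ d, ∑ q, Real.sqrt |(h y).det| *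
          (perm a p q * (G d p * cov2 h T y d c b * G c q)) := by
          rw [Finset.sum_comm]
          exact Finset.sum_congr rfl fun c _ => Finset.sum_congr rfl fun p _ => Finset.sum_comm
      _ = ∑ c, ∑ d, ∑ p, ∑ q, Real.sqrt |(h y).det| *
          (perm a p q * (G d p * cov2 h T y d c b * G c q)) :=
          Finset.sum_congr rfl fun c _ => Finset.sum_comm
      _ = _ := by
          rw [Finset.sum_comm]
          refine Finset.sum_congr rfl fun c _ => Finset.sum_congr rfl fun d _ =>
            Finset.sum_congr rfl fun p _ => Finset.sum_congr rfl fun q _ => ?_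
          ring
  have hNs : N.transpose = N := by
    have h0 := hperm 0
    have h1 := hperm 1
    have h2 := hperm 2
    simp [Fin.sum_univ_three, perm] at h0 h1 h2
    ext p q
    rw [Matrix.transpose_apply]
    fin_cases p <;> fin_cases q <;> simp <;> linarith
  have hu : IsUnit (h y).det := isUnit_iff_ne_zero.2 (det_h_ne_zero hy)
  have hht : (h y).transpose = h y := by
    ext p q
    exact h_symm y q p
  have hSN : S = (h y) * N * (h y) := by
    have hGt : G.transpose = G := by rw [hG, Matrix.transpose_nonsing_inv, hht]
    rw [hN, hGt, mul_assoc, mul_assoc, mul_assoc, Matrix.nonsing_inv_mul _ hu, mul_one,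
      ← mul_assoc, Matrix.mul_nonsing_inv _ hu, one_mul]
  have hSs : S.transpose = S := by
    rw [hSN, Matrix.transpose_mul, Matrix.transpose_mul, hNs, hht]
    exact (Matrix.mul_assoc _ _ _).symm
  exact congrFun (congrFun hSs d) c

/-! ### Hessians -/

theorem hess_congr {f g : Coord → ℝ} (hfg : ∀ z ∈ U, f z = g z) {y : Coord} (hy : y ∈ U)
    (a b : Fin 3) : hess h f y a b = hess h g y a b := by
  have h1 : ∀ c, ∀ z ∈ U, pd c f z = pd c g z := fun c z hz => pd_congr hfg c hz
  simp only [hess, cov1, pd_congr (h1 b) a hy, h1 _ y hy]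

theorem hess_add {f g : Coord → ℝ} (hf : ContDiffOn ℝ ∞ f U) (hg : ContDiffOn ℝ ∞ g U)
    {y : Coord} (hy : y ∈ U) (a b : Fin 3) :
    hess h (fun z => f z + g z) y a b = hess h f y a b + hess h g y a b := by
  have h1 : ∀ c, ∀ z ∈ U, pd c (fun z => f z + g z) z = pd c f z + pd c g z := fun c z hz =>
    pd_add (differentiableAt_of_contDiffOn_U hf hz) (differentiableAt_of_contDiffOn_U hg hz) c
  simp only [hess, cov1, pd_congr (h1 b) a hy, h1 _ y hy, mul_add, Finset.sum_add_distrib]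
  rw [pd_add (differentiableAt_of_contDiffOn_U (contDiffOn_pd hf b) hy)
    (differentiableAt_of_contDiffOn_U (contDiffOn_pd hg b) hy)]
  ring

/-- The trace of the equation `T_{ab} = D_a D_b Φ + h_{ab} Φ` for a traceless `T` is
`□Φ + 3Φ = 0`. -/
theorem isPotential_of_hess {T : Coord → Fin 3 → Fin 3 → ℝ}
    (T_traceless : ∀ y ∈ U, tr h T y = 0) {Φ : Coord → ℝ} (hΦ : ContDiffOn ℝ ∞ Φ U)
    (hT : ∀ y ∈ U, ∀ a b, T y a b = hess h Φ y a b + h y a b * Φ y) : IsPotential T Φ := by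
  refine ⟨hΦ, fun y hy => ?_, hT⟩
  rw [← T_traceless y hy]
  have h1 : ∀ a, ∑ b, (h y)⁻¹ a b * h y a b = 1 := by
    intro a
    have h2 := inv_h_mul_h hy a a
    rw [if_pos rfl] at h2
    rw [← h2]
    exact Finset.sum_congr rfl fun b _ => by rw [h_symm]
  simp only [tr, box0, hT y hy, mul_add, Finset.sum_add_distrib, ← mul_assoc, ← Finset.sum_mul,
    h1]
  simp

/-- If the derivative of `w : U → ℝ⁴` is tangent to the hyperboloid, with components `T_{ab}`, then
`Φ = ⟨w, x⟩` satisfies `D_a D_b Φ + h_{ab} Φ = T_{ab}`. -/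
theorem hess_mink_embed {w : Coord → Fin 4 → ℝ} (hw : ∀ m, ContDiffOn ℝ ∞ (fun z => w z m) U)
    {T : Coord → Fin 3 → Fin 3 → ℝ}
    (htan : ∀ y ∈ U, ∀ a b, mink (fun m => pd a (fun z => w z m) y) (tangent y b) = T y a b)
    (hemb : ∀ y ∈ U, ∀ a, mink (fun m => pd a (fun z => w z m) y) (embed y) = 0)
    {y : Coord} (hy : y ∈ U) (a b : Fin 3) :
    T y a b = hess h (fun z => mink (w z) (embed z)) y a b +
      h y a b * mink (w y) (embed y) := by
  have h1 : ∀ c, ∀ z ∈ U, pd c (fun z => mink (w z) (embed z)) z = mink (w z) (tangent z c) := by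
    intro c z hz
    rw [pd_mink hw contDiffOn_embed c hz, hemb z hz, zero_add]
    rfl
  have h2 : pd a (fun z => mink (w z) (tangent z b)) y =
      T y a b + mink (w y) (tangentDeriv y a b) := by
    rw [pd_mink hw (contDiffOn_tangent b) a hy, htan y hy]
    rfl
  simp only [hess, cov1, pd_congr (h1 b) a hy, h1 _ y hy]
  rw [h2, tangentDeriv_eq hy, mink_sub_right, mink_sum_right]
  simp only [mink_smul_right]
  ring

/-! ### Existence and uniqueness of the potential -/

/-- The potential is `⟨w, x⟩`, where `w` is a primitive of `v_a = T_a{}^b ∂_b x`. -/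
theorem exists_hess_eq {T : Coord → Fin 3 → Fin 3 → ℝ}
    (T_smooth : ∀ a b, ContDiffOn ℝ ∞ (fun y => T y a b) U)
    (T_symm : ∀ y ∈ U, ∀ a b, T y a b = T y b a)
    (T_curlfree : ∀ y ∈ U, ∀ a b, curl h T y a b = 0) :
    ∃ Φ : Coord → ℝ, ContDiffOn ℝ ∞ Φ U ∧
      ∀ y ∈ U, ∀ a b, T y a b = hess h Φ y a b + h y a b * Φ y := by
  -- The fields `v_a = T_a{}^b ∂_b x`, given by `lift z (T z a) 0`.
  have hV : ∀ a m, ContDiffOn ℝ ∞ (fun z => lift z (T z a) 0 m) U := fun a m =>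
    contDiffOn_lift (T_smooth a) contDiffOn_const m
  have htan : ∀ y ∈ U, ∀ a c b, mink (fun m => pd c (fun z => lift z (T z a) 0 m) y)
      (tangent y b) = cov2 h T y c a b + ∑ e, christoffel h y e c a * T y e b := by
    intro y hy a c b
    have h1 := pd_mink (hV a) (contDiffOn_tangent b) c hy
    rw [pd_congr (fun z hz => mink_lift_tangent hz (T z a) 0 b) c hy] at h1
    change _ = _ + mink (lift y (T y a) 0) (tangentDeriv y c b) at h1
    rw [tangentDeriv_eq hy, mink_sub_right, mink_sum_right, mink_smul_right,
      mink_lift_embed hy] at h1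
    simp only [mink_smul_right, mink_lift_tangent hy] at h1
    rw [cov2, h1]
    ring
  have hemb : ∀ y ∈ U, ∀ a c, mink (fun m => pd c (fun z => lift z (T z a) 0 m) y) (embed y) =
      -T y a c := by
    intro y hy a c
    have h1 := pd_mink (hV a) contDiffOn_embed c hy
    rw [pd_congr (fun z hz => mink_lift_embed hz (T z a) 0) c hy, pd_const] at h1
    change 0 = _ + mink (lift y (T y a) 0) (tangent y c) at h1
    rw [mink_lift_tangent hy] at h1
    linarith
  have hclosed : ∀ y ∈ U, ∀ a c, (fun m => pd c (fun z => lift z (T z a) 0 m) y) =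
      fun m => pd a (fun z => lift z (T z c) 0 m) y := by
    intro y hy a c
    refine eq_of_mink_eq hy (fun b => ?_) ?_
    · rw [htan y hy, htan y hy, cov2_comm_of_curl_eq_zero hy (T_curlfree y hy)]
      simp only [christoffel_comm hy _ a c]
    · rw [hemb y hy, hemb y hy, T_symm y hy]
  choose w hw hpd using fun m => exists_pd_eq_of_closed (fun a => hV a m)
    fun y hy a c => congrFun (hclosed y hy a c) m
  have hder : ∀ y ∈ U, ∀ a, (fun m => pd a (w m) y) = lift y (T y a) 0 := fun y hy a =>
    funext fun m => hpd m y hy a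
  refine ⟨fun z => mink (fun m => w m z) (embed z), contDiffOn_mink hw contDiffOn_embed,
    fun y hy => hess_mink_embed hw (fun z hz a b => ?_) (fun z hz a => ?_) hy⟩
  · rw [hder z hz, mink_lift_tangent hz]
  · rw [hder z hz, mink_lift_embed hz]

/-- The solutions of `D_a D_b Θ + h_{ab} Θ = 0` are the restrictions to the hyperboloid of the
linear functions on `ℝ⁴`. -/
theorem hess_add_h_mul_eq_zero_iff {Θ : Coord → ℝ} (hΘ : ContDiffOn ℝ ∞ Θ U) :
    (∀ y ∈ U, ∀ a b, hess h Θ y a b + h y a b * Θ y = 0) ↔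
      ∃ k : Fin 4 → ℝ, ∀ y ∈ U, Θ y = mink k (embed y) := by
  constructor
  · intro hess0
    -- `w = D^aΘ ∂_a x + Θ x` is constant.
    have hw : ∀ m, ContDiffOn ℝ ∞ (fun z => lift z (fun a => pd a Θ z) (Θ z) m) U :=
      contDiffOn_lift (fun a => contDiffOn_pd hΘ a) hΘ
    have hzero : ∀ y ∈ U, ∀ a,
        (fun m => pd a (fun z => lift z (fun a => pd a Θ z) (Θ z) m) y) = 0 := by
      intro y hy a
      refine eq_zero_of_mink_eq_zero hy (fun b => ?_) ?_
      · have h1 := pd_mink hw (contDiffOn_tangent b) a hy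
        rw [pd_congr (fun z hz => mink_lift_tangent hz _ _ b) a hy] at h1
        change _ = _ + mink (lift y _ _) (tangentDeriv y a b) at h1
        rw [tangentDeriv_eq hy, mink_sub_right, mink_sum_right, mink_smul_right,
          mink_lift_embed hy] at h1
        simp only [mink_smul_right, mink_lift_tangent hy] at h1
        have h2 := hess0 y hy a b
        simp only [hess, cov1] at h2
        linarith
      · have h1 := pd_mink hw contDiffOn_embed a hy
        rw [pd_congr (fun z hz => mink_lift_embed hz _ _) a hy] at h1
        change _ = _ + mink (lift y _ _) (tangent y a) at h1
        rw [mink_lift_tangent hy] at h1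
        linarith
    choose k hk using fun m => exists_const_of_pd_eq_zero (hw m)
      fun y hy a => congrFun (hzero y hy a) m
    refine ⟨k, fun y hy => ?_⟩
    rw [← mink_lift_embed hy (fun a => pd a Θ y) (Θ y)]
    congr 1
    exact funext fun m => hk m y hy
  · rintro ⟨k, hk⟩ y hy a b
    rw [hess_congr hk hy, hk y hy]
    refine (hess_mink_embed (w := fun _ => k) (T := fun _ _ _ => 0) (fun m => contDiffOn_const)
      (fun z _ a b => ?_) (fun z _ a => ?_) hy a b).symm <;>
    simp [pd_const, mink]

/-- The functions `ζ₍ᵢ₎` are the components `x₀, x₃, x₁, x₂`, in this order. -/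
theorem exists_mink_embed_eq_iff (f : Coord → ℝ) :
    (∃ k : Fin 4 → ℝ, ∀ y ∈ U, f y = mink k (embed y)) ↔
      ∃ c : Fin 4 → ℝ, ∀ y ∈ U, f y = ∑ i, c i * zeta i y := by
  have hz : ∀ (c : Fin 4 → ℝ) (y : Coord), ∑ i, c i * zeta i y =
      mink ![-c 0, c 2, c 3, c 1] (embed y) := by
    intro c y
    have z0 : zeta 0 y = Real.sinh (tau y) := rfl
    have z1 : zeta 1 y = Real.cosh (tau y) * (y 2 / ‖y‖) := rfl
    have z2 : zeta 2 y = Real.cosh (tau y) * (y 0 / ‖y‖) := rfl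
    have z3 : zeta 3 y = Real.cosh (tau y) * (y 1 / ‖y‖) := rfl
    simp [mink, eta, embed, Fin.sum_univ_four, z0, z1, z2, z3]
    ring
  constructor
  · rintro ⟨k, hk⟩
    refine ⟨![-k 0, k 3, k 1, k 2], fun y hy => ?_⟩
    rw [hk y hy, hz]
    congr 1
    ext m
    fin_cases m <;> simp
  · rintro ⟨c, hc⟩
    exact ⟨_, fun y hy => (hc y hy).trans (hz c y)⟩

end DeSitter
end

theorem lemma1 (T : DeSitter.Coord → Fin 3 → Fin 3 → ℝ)
    (T_smooth : ∀ a b, ContDiffOn ℝ ∞ (fun y => T y a b) DeSitter.U)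
    (T_symm : ∀ y ∈ DeSitter.U, ∀ a b, T y a b = T y b a)
    (T_traceless : ∀ y ∈ DeSitter.U, DeSitter.tr DeSitter.h T y = 0)
    (T_curlfree : ∀ y ∈ DeSitter.U, ∀ a b, DeSitter.curl DeSitter.h T y a b = 0)
    (T_divfree : ∀ y ∈ DeSitter.U, ∀ a, DeSitter.dvg DeSitter.h T y a = 0)
    (T_box : ∀ y ∈ DeSitter.U, ∀ a b, DeSitter.box2 DeSitter.h T y a b = 3 * T y a b) :
    ∃ Φ : DeSitter.Coord → ℝ, DeSitter.IsPotential T Φ ∧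
      ∀ Ψ : DeSitter.Coord → ℝ, DeSitter.IsPotential T Ψ ↔
        ∃ c : Fin 4 → ℝ, ∀ y ∈ DeSitter.U,
          Ψ y = Φ y + ∑ i, c i * DeSitter.zeta i y := by
  open DeSitter in
  obtain ⟨Φ, hΦ, hT⟩ := exists_hess_eq T_smooth T_symm T_curlfree
  refine ⟨Φ, isPotential_of_hess T_traceless hΦ hT, fun Ψ => ?_⟩
  have hiff : (∃ c : Fin 4 → ℝ, ∀ y ∈ U, Ψ y = Φ y + ∑ i, c i * zeta i y) ↔
      ∃ k : Fin 4 → ℝ, ∀ y ∈ U, Ψ y - Φ y = mink k (embed y) := by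
    rw [exists_mink_embed_eq_iff]
    simp only [sub_eq_iff_eq_add']
  rw [hiff]
  have hsum : ContDiffOn ℝ ∞ Ψ U → ∀ y ∈ U, ∀ a b,
      hess h Ψ y a b = hess h Φ y a b + hess h (fun z => Ψ z - Φ z) y a b := by
    intro hΨ y hy a b
    rw [← hess_add hΦ (hΨ.sub hΦ) hy]
    exact hess_congr (fun z _ => (add_sub_cancel _ _).symm) hy a b
  constructor
  · rintro ⟨hΨ, -, hTΨ⟩
    refine (hess_add_h_mul_eq_zero_iff (hΨ.sub hΦ)).1 fun y hy a b => ?_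
    linear_combination hT y hy a b - hTΨ y hy a b - hsum hΨ y hy a b
  · rintro ⟨k, hk⟩
    have hΨ : ContDiffOn ℝ ∞ Ψ U :=
      (hΦ.add (contDiffOn_mink (fun m => contDiffOn_const (c := k m)) contDiffOn_embed)).congr
        fun y hy => (sub_eq_iff_eq_add'.1 (hk y hy))
    refine isPotential_of_hess T_traceless hΨ fun y hy a b => ?_
    have h0 := (hess_add_h_mul_eq_zero_iff (hΨ.sub hΦ)).2 ⟨k, hk⟩ y hy a b
    linear_combination hT y hy a b - hsum hΨ y hy a b - h0
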